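/- **Setting.** A $k$-armed bandit instance is a tuple $\nu=(\nu_1,\dots,\nu_k)$ of probability distributions on $\mathbb{R}$ with finite means $\mu_i$; $\Delta_i=\max_j\mu_j-\mu_i$. All rewards are independent, those of arm $i$ having law $\nu_i$. If $T_i(n)$ is the number of pulls of arm $i$ in the first $n$ rounds, the regret is $R_n(\nu)=\sum_{i=1}^k\Delta_i\,\mathbb{E}[T_i(n)]$. For $\epsilon,B>0$ let $\mathcal{G}(\epsilon,B)$ be the set of distributions $F$ with $\int|x|^{1+\epsilon}\,dF(x)\le B$, and $\mathcal{G}=\bigcup_{\epsilon,B>0}\mathcal{G}(\epsilon,B)$. Let $f:\mathbb{N}\to(1,\infty)$ be slow growing: $f$ is nondecreasing, $f(t)\to\infty$, and $f(t)/t^a\to0$ for every $a>0$. The algorithm R-UCB-G with scaling function $f$ pulls each arm once in rounds $1,\dots,k$, and in each round $t>k$ pulls an arm $i$ (ties broken by any measurable function of the past) that maximizes $$\frac1{u_i}\sum_{X\in\mathcal{R}_i}X\,\mathbf{1}\{|X|\le f(t)\}+\frac1{\log f(t)}+\frac{16f(t)\log t}{u_i},$$ where $\mathcal{R}_i$ is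 the collection of rewards observed so far from arm $i$ and $u_i$ is their number. The algorithm uses neither $\epsilon$ nor $B$. **Theorem.** Let $f$ be as above. 1. For all $\epsilon,B,\delta>0$ there is a threshold $t_{\min}$, depending only on $f,\epsilon,B,\delta$, such that for every $k$, every instance $\nu\in\mathcal{G}(\epsilon,B)^k$ all of whose positive gaps are at least $\delta$, and every $t>t_{\min}$, one has $1-\frac{2}{\Delta_i\log f(t)}>0$ for all $i$ with $\Delta_i>0$, and the regret of R-UCB-G satisfies $$R_t(\nu)\le\sum_{i:\Delta_i>0}\left(\frac{32f(t)\log t}{1-\frac{2}{\Delta_i\log f(t)}}+4\Delta_i\right).$$ 2. Consequently, for every $k$ and every $\nu\in\mathcal{G}^k$, $R_n(\nu)=O(f(n)\log n)$, and R-UCB-G is consistent over $\mathcal{G}^k$: $R_n(\nu)=o(n^a)$ for every $\nu\in\mathcal{G}^k$ and every $a>0$. -/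

import Mathlib

open MeasureTheory Filter Topology Asymptotics

noncomputable section

namespace Bandit

/-- A function `f : ℕ → (0, ∞)` is slow growing if it is nondecreasing, tends to infinity, and
grows more slowly than every positive power of `t`. -/
structure SlowGrowing (f : ℕ → ℝ) : Prop where
  pos : ∀ t, 0 < f t
  le_succ : ∀ t, f t ≤ f (t + 1)
  tendsto_atTop : Tendsto f atTop atTop
  tendsto_div_rpow : ∀ a : ℝ, 0 < a → Tendsto (fun t : ℕ => f t / (t : ℝ) ^ a) atTop (𝓝 0)

/-- The reward distributions whose `(1 + ε)`-th absolute moment is at most `B`. -/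
def momentClass (ε B : ℝ) : Set (ProbabilityMeasure ℝ) :=
  {F | ∫⁻ x, ENNReal.ofReal (|x| ^ (1 + ε)) ∂(F : Measure ℝ) ≤ ENNReal.ofReal B}

/-- The reward distributions with a finite `(1 + ε)`-th absolute moment for some `ε > 0`. -/
def heavyClass : Set (ProbabilityMeasure ℝ) :=
  {F | ∃ ε : ℝ, 0 < ε ∧ ∫⁻ x, ENNReal.ofReal (|x| ^ (1 + ε)) ∂(F : Measure ℝ) < ⊤}

/-- The mean of a reward distribution. -/
def mean (F : ProbabilityMeasure ℝ) : ℝ := ∫ x, x ∂(F : Measure ℝ)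

/-- The sub-optimality gap of arm `i`: the largest mean minus the mean of arm `i`. -/
def gap {k : ℕ} (ν : Fin k → ProbabilityMeasure ℝ) (i : Fin k) : ℝ :=
  (⨆ j, mean (ν j)) - mean (ν i)

/-- The record of the first `n` rounds: in each round the arm pulled and the reward observed. -/
abbrev History (k n : ℕ) : Type := Fin n → Fin k × ℝ

/-- A policy chooses the arm of round `n + 1` as a measurable function of the first `n` rounds. -/
structure Policy (k : ℕ) where
  arm : (n : ℕ) → History k n → Fin k
  measurable_arm : ∀ n, Measurable (arm n)

/-- The number of pulls of arm `i` recorded in a history. -/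
def pulls {k n : ℕ} (h : History k n) (i : Fin k) : ℕ :=
  (Finset.univ.filter fun s => (h s).1 = i).card

/-- The first `n` rounds of a policy when the `(j + 1)`-st pull of arm `i` yields `x (i, j)`. -/
def history {k : ℕ} (π : Policy k) (x : Fin k × ℕ → ℝ) : (n : ℕ) → History k n
  | 0 => Fin.elim0
  | n + 1 =>
      Fin.snoc (α := fun _ => Fin k × ℝ) (history π x n)
        (π.arm n (history π x n),
          x (π.arm n (history π x n), pulls (history π x n) (π.arm n (history π x n))))

/-- The law of the rewards: all of them are independent, those of arm `i` have law `ν i`. -/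
def rewardLaw {k : ℕ} (ν : Fin k → ProbabilityMeasure ℝ) : Measure (Fin k × ℕ → ℝ) :=
  Measure.infinitePi fun p : Fin k × ℕ => (ν p.1 : Measure ℝ)

/-- The regret `∑ i, Δ_i E[T_i(n)]` of a policy after `n` rounds, where `T_i(n)` is the number of
pulls of arm `i` in these rounds. -/
def regret {k : ℕ} (π : Policy k) (ν : Fin k → ProbabilityMeasure ℝ) (n : ℕ) : ℝ :=
  ∑ i, gap ν i * ∫ x, (pulls (history π x n) i : ℝ) ∂(rewardLaw ν)

/-- A policy is consistent over `M ^ k` if its regret is `o(n ^ a)` for every `a > 0` on every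
instance in `M ^ k`. -/
def Consistent {k : ℕ} (π : Policy k) (M : Set (ProbabilityMeasure ℝ)) : Prop :=
  ∀ ν : Fin k → ProbabilityMeasure ℝ, (∀ i, ν i ∈ M) → ∀ a : ℝ, 0 < a →
    (fun n : ℕ => regret π ν n) =o[atTop] (fun n : ℕ => (n : ℝ) ^ a)

/-- The empirical mean of arm `i` in a history, truncated at level `b`. -/
def truncMean {k n : ℕ} (h : History k n) (i : Fin k) (b : ℝ) : ℝ :=
  (1 / (pulls h i : ℝ)) *
    ∑ s ∈ Finset.univ.filter (fun s => (h s).1 = i), if |(h s).2| ≤ b then (h s).2 else 0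

/-- The confidence width in round `t` after `u` pulls. -/
def width (f : ℕ → ℝ) (u t : ℕ) : ℝ :=
  1 / Real.log (f t) + 16 * f t * Real.log t / u

/-- The upper confidence bound of arm `i` in round `n + 1`, given the first `n` rounds. -/
def ucb (f : ℕ → ℝ) {k n : ℕ} (h : History k n) (i : Fin k) : ℝ :=
  truncMean h i (f (n + 1)) + width f (pulls h i) (n + 1)

/-- The policy follows R-UCB-G with scaling function `f` (with any rule for breaking ties): it
pulls each arm once in the first `k` rounds, in order, and afterwards an arm that maximizes the
upper confidence bound. -/
structure IsRUCBG (f : ℕ → ℝ) {k : ℕ} (π : Policy k) : Prop where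
  init : ∀ n (h : History k n), n < k → (π.arm n h : ℕ) = n
  maximize : ∀ n (h : History k n), k ≤ n → (∀ j, 0 < pulls h j) →
    ∀ j, ucb f h j ≤ ucb f h (π.arm n h)

end Bandit

end

open ProbabilityTheory

namespace Bandit

/-! ### Histories -/

/-! Truncating at `b` and taking a Chernoff bound at the matching rate `1 / b` handles bias and
fluctuation together. Since `e^z ≤ 1 + z + z ^ 2` for `|z| ≤ 1`, the truncated exponential is
dominated by `1 + z + |z| ^ (1 + ε)` with `z = ± x / b` untruncated, so its integral involves the
true mean and an excess of at most `B * b ^ (-ε)` per sample (`integral_exp_truncate_le_one`). With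
`b = f t`, this excess is eventually below `1 / log (f t)`, whatever `ε` and `B` are; this is why
the algorithm need not know them.

Outside rare deviation events, pulling a suboptimal arm forces its gap below twice its width
(`IsRUCBG.mean_sub_mean_lt`). Past `L = 32 f(t) log t / (Δ - 2 / log f(t))` pulls this is
impossible, so every further pull is charged to a deviation event, and these have summable
probabilities (`IsRUCBG.integral_pulls_le`).

Two points are delicate. The width is not monotone in the round, so a bound at the horizon must be
carried back to earlier rounds (`two_mul_width_le`). And the bounds fail before some round `s₀`;
those rounds cost nothing extra once `s₀ ≤ L`, which holds uniformly in the instance because the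
moment bound also bounds the gaps. -/

lemma pulls_eq_sum {k n : ℕ} (h : History k n) (i : Fin k) :
    pulls h i = ∑ s, if (h s).1 = i then 1 else 0 := by
  rw [pulls, Finset.card_filter]

lemma pulls_snoc {k n : ℕ} (h : History k n) (p : Fin k × ℝ) (i : Fin k) :
    pulls (Fin.snoc (α := fun _ => Fin k × ℝ) h p : History k (n + 1)) i =
      pulls h i + if p.1 = i then 1 else 0 := by
  rw [pulls_eq_sum, pulls_eq_sum, Fin.sum_univ_castSucc]
  simp only [Fin.snoc_castSucc, Fin.snoc_last]

lemma pulls_history_zero {k : ℕ} (π : Policy k) (x : Fin k × ℕ → ℝ) (i : Fin k) :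
    pulls (history π x 0) i = 0 := by
  simp [pulls]

lemma pulls_history_succ {k : ℕ} (π : Policy k) (x : Fin k × ℕ → ℝ) (n : ℕ) (i : Fin k) :
    pulls (history π x (n + 1)) i =
      pulls (history π x n) i + if π.arm n (history π x n) = i then 1 else 0 := by
  rw [history, pulls_snoc]

lemma pulls_le {k n : ℕ} (h : History k n) (i : Fin k) : pulls h i ≤ n := by
  simpa [pulls] using Finset.card_filter_le (Finset.univ : Finset (Fin n)) (fun s => (h s).1 = i)

/-- Links the adaptive history to sums of a deterministic number of independent variables: a union
bound over that number then replaces any stopping-time argument. -/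
lemma sum_rewards_history {k : ℕ} (π : Policy k) (x : Fin k × ℕ → ℝ) (g : ℝ → ℝ) (i : Fin k)
    (n : ℕ) :
    ∑ s with (history π x n s).1 = i, g (history π x n s).2 =
      ∑ j ∈ Finset.range (pulls (history π x n) i), g (x (i, j)) := by
  induction n with
  | zero => simp [pulls]
  | succ n ih =>
    rw [Finset.sum_filter] at ih ⊢
    rw [pulls_history_succ, Fin.sum_univ_castSucc]
    simp only [history, Fin.snoc_castSucc, Fin.snoc_last]
    rw [ih]
    split_ifs with h
    · rw [Finset.sum_range_succ, h]
    · simp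

lemma IsRUCBG.pulls_eq_zero {f : ℕ → ℝ} {k : ℕ} {π : Policy k} (hπ : IsRUCBG f π)
    (x : Fin k × ℕ → ℝ) (i : Fin k) {n : ℕ} (hn : n ≤ i) : pulls (history π x n) i = 0 := by
  induction n with
  | zero => exact pulls_history_zero π x i
  | succ n ih =>
    have h := hπ.init n (history π x n) (by omega)
    rw [pulls_history_succ, ih (by omega), if_neg]
    rintro rfl
    omega

lemma IsRUCBG.pulls_pos {f : ℕ → ℝ} {k : ℕ} {π : Policy k} (hπ : IsRUCBG f π)
    (x : Fin k × ℕ → ℝ) (i : Fin k) {n : ℕ} (hn : i < n) : 0 < pulls (history π x n) i := by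
  induction n with
  | zero => omega
  | succ n ih =>
    rw [pulls_history_succ]
    rcases Nat.lt_succ_iff_lt_or_eq.mp hn with h | h
    · have := ih h
      omega
    · have h' := hπ.init n (history π x n) (by omega)
      rw [if_pos (Fin.ext (by omega))]
      omega

/-! ### Truncated rewards -/

/-- The truncation of a real number at level `b`. -/
noncomputable def truncate (b y : ℝ) : ℝ := if |y| ≤ b then y else 0

lemma measurable_truncate (b : ℝ) : Measurable (truncate b) :=
  Measurable.ite (measurableSet_le (by fun_prop) (by fun_prop)) measurable_id measurable_const

lemma abs_truncate_le {b : ℝ} (hb : 0 ≤ b) (y : ℝ) : |truncate b y| ≤ b := by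
  unfold truncate
  split_ifs with h
  · exact h
  · simpa using hb

lemma truncMean_history {k : ℕ} (π : Policy k) (x : Fin k × ℕ → ℝ) (i : Fin k) (b : ℝ) (n : ℕ) :
    truncMean (history π x n) i b =
      (∑ j ∈ Finset.range (pulls (history π x n) i), truncate b (x (i, j))) /
        pulls (history π x n) i := by
  rw [truncMean, one_div_mul_eq_div, ← sum_rewards_history π x (truncate b)]
  rfl

/-! ### Moments -/

lemma abs_rpow_le_one_add {p q : ℝ} (hp : 0 ≤ p) (hpq : p ≤ q) (x : ℝ) :
    |x| ^ p ≤ 1 + |x| ^ q := by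
  rcases le_total |x| 1 with h | h
  · have := Real.rpow_le_one (abs_nonneg x) h hp
    have := Real.rpow_nonneg (abs_nonneg x) q
    linarith
  · have := Real.rpow_le_rpow_of_exponent_le h hpq
    linarith

lemma integrable_abs_rpow {F : ProbabilityMeasure ℝ} {p : ℝ}
    (h : ∫⁻ x, ENNReal.ofReal (|x| ^ p) ∂(F : Measure ℝ) < ⊤) :
    Integrable (fun x => |x| ^ p) (F : Measure ℝ) := by
  refine ⟨(by fun_prop : Measurable fun x : ℝ => |x| ^ p).aestronglyMeasurable, ?_⟩
  rw [hasFiniteIntegral_iff_ofReal (ae_of_all _ fun x => Real.rpow_nonneg (abs_nonneg x) p)]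
  exact h

lemma mem_momentClass_iff {F : ProbabilityMeasure ℝ} {ε B : ℝ} (hB : 0 ≤ B) :
    F ∈ momentClass ε B ↔ Integrable (fun x => |x| ^ (1 + ε)) (F : Measure ℝ) ∧
      ∫ x, |x| ^ (1 + ε) ∂(F : Measure ℝ) ≤ B := by
  have h0 : 0 ≤ᵐ[(F : Measure ℝ)] fun x : ℝ => |x| ^ (1 + ε) :=
    ae_of_all _ fun x => Real.rpow_nonneg (abs_nonneg x) _
  constructor
  · intro h
    have hi : Integrable (fun x => |x| ^ (1 + ε)) (F : Measure ℝ) :=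
      integrable_abs_rpow (lt_of_le_of_lt h ENNReal.ofReal_lt_top)
    refine ⟨hi, ?_⟩
    rw [← ENNReal.ofReal_le_ofReal_iff hB, ofReal_integral_eq_lintegral_ofReal hi h0]
    exact h
  · rintro ⟨hi, h⟩
    rw [momentClass, Set.mem_ofPred_eq, ← ofReal_integral_eq_lintegral_ofReal hi h0]
    exact ENNReal.ofReal_le_ofReal h

lemma momentClass_subset {ε ε' B : ℝ} (hε' : -1 ≤ ε') (h : ε' ≤ ε) (hB : 0 ≤ B) :
    momentClass ε B ⊆ momentClass ε' (1 + B) := by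
  intro F hF
  rw [mem_momentClass_iff hB] at hF
  rw [mem_momentClass_iff (by linarith)]
  have hle : ∀ x : ℝ, |x| ^ (1 + ε') ≤ 1 + |x| ^ (1 + ε) :=
    abs_rpow_le_one_add (by linarith) (by linarith)
  have hi : Integrable (fun x : ℝ => 1 + |x| ^ (1 + ε)) (F : Measure ℝ) :=
    (integrable_const 1).add hF.1
  have hi' : Integrable (fun x : ℝ => |x| ^ (1 + ε')) (F : Measure ℝ) := by
    refine hi.mono' (by fun_prop : Measurable fun x : ℝ => |x| ^ (1 + ε')).aestronglyMeasurable
      (ae_of_all _ fun x => ?_)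
    rw [Real.norm_of_nonneg (Real.rpow_nonneg (abs_nonneg x) _)]
    exact hle x
  refine ⟨hi', (integral_mono hi' hi hle).trans ?_⟩
  rw [integral_add (integrable_const 1) hF.1]
  simpa using hF.2

lemma momentClass_mono {ε B B' : ℝ} (h : B ≤ B') : momentClass ε B ⊆ momentClass ε B' :=
  fun _ hF => le_trans hF (ENNReal.ofReal_le_ofReal h)

lemma integrable_id_of_mem_momentClass {F : ProbabilityMeasure ℝ} {ε B : ℝ} (hε : 0 ≤ ε)
    (hB : 0 ≤ B) (hF : F ∈ momentClass ε B) : Integrable (fun x => x) (F : Measure ℝ) := by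
  rw [mem_momentClass_iff hB] at hF
  refine ((integrable_const (1 : ℝ)).add hF.1).mono' (by fun_prop) (ae_of_all _ fun x => ?_)
  simpa using abs_rpow_le_one_add zero_le_one (show (1 : ℝ) ≤ 1 + ε by linarith) x

lemma abs_mean_le {F : ProbabilityMeasure ℝ} {ε B : ℝ} (hε : 0 ≤ ε) (hB : 0 ≤ B)
    (hF : F ∈ momentClass ε B) : |mean F| ≤ 1 + B := by
  have h1 := hF
  rw [mem_momentClass_iff hB] at h1
  calc |mean F| ≤ ∫ x, |x| ∂(F : Measure ℝ) := abs_integral_le_integral_abs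
    _ ≤ ∫ x, (1 + |x| ^ (1 + ε)) ∂(F : Measure ℝ) := by
      refine integral_mono (integrable_id_of_mem_momentClass hε hB hF).abs
        ((integrable_const (1 : ℝ)).add h1.1) fun x => ?_
      simpa using abs_rpow_le_one_add zero_le_one (show (1 : ℝ) ≤ 1 + ε by linarith) x
    _ ≤ 1 + B := by
      rw [integral_add (integrable_const 1) h1.1]
      simpa using h1.2

/-! ### Concentration -/

/-- For `|z| ≤ 1`, `ε ≤ 1` gives `z ^ 2 ≤ |z| ^ (1 + ε)`. Beyond the truncation level the left side
is `1`, and `|z| ^ (1 + ε)` absorbs a negative `z`. -/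
lemma exp_truncate_le {ε b σ : ℝ} (hε : 0 < ε) (hε1 : ε ≤ 1) (hb : 0 < b) (hσ : |σ| = 1) (x : ℝ) :
    Real.exp (b⁻¹ * (σ * truncate b x)) ≤
      1 + b⁻¹ * (σ * x) + (b ^ (1 + ε))⁻¹ * |x| ^ (1 + ε) := by
  set z := b⁻¹ * (σ * x) with hz
  have hzabs : |z| = |x| / b := by
    rw [hz, abs_mul, abs_mul, hσ, abs_of_pos (inv_pos.mpr hb)]
    ring
  have hpow : (b ^ (1 + ε))⁻¹ * |x| ^ (1 + ε) = |z| ^ (1 + ε) := by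
    rw [hzabs, Real.div_rpow (abs_nonneg x) hb.le]
    ring
  rw [hpow]
  by_cases h : |x| ≤ b
  · have hz1 : |z| ≤ 1 := by rw [hzabs, div_le_one hb]; exact h
    rw [truncate, if_pos h, ← hz]
    have h1 := (abs_le.mp (Real.abs_exp_sub_one_sub_id_le hz1)).2
    have h2 : z ^ 2 ≤ |z| ^ (1 + ε) := by
      rcases (abs_nonneg z).eq_or_lt with h0 | h0
      · rw [abs_eq_zero.mp h0.symm]
        simpa using Real.rpow_nonneg le_rfl (1 + ε)
      · rw [← sq_abs, ← Real.rpow_natCast]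
        exact Real.rpow_le_rpow_of_exponent_ge h0 hz1 (by push_cast; linarith)
    linarith
  · have hz1 : 1 ≤ |z| := by rw [hzabs, le_div_iff₀ hb]; linarith
    rw [truncate, if_neg h]
    have h1 : |z| ≤ |z| ^ (1 + ε) := by
      simpa using Real.rpow_le_rpow_of_exponent_le hz1 (show (1 : ℝ) ≤ 1 + ε by linarith)
    have h2 := neg_abs_le z
    simp only [mul_zero, Real.exp_zero]
    linarith

lemma integrable_exp_of_abs_le {Ω : Type*} [MeasurableSpace Ω] {μ : Measure Ω} [IsFiniteMeasure μ]
    {g : Ω → ℝ} (hg : Measurable g) {C : ℝ} (h : ∀ x, |g x| ≤ C) :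
    Integrable (fun x => Real.exp (g x)) μ := by
  refine (integrable_const (Real.exp C)).mono' (by fun_prop) (ae_of_all _ fun x => ?_)
  rw [Real.norm_of_nonneg (Real.exp_pos _).le]
  exact Real.exp_le_exp.mpr ((le_abs_self _).trans (h x))

lemma integral_exp_truncate_le_one {F : ProbabilityMeasure ℝ} {ε B b c σ : ℝ} (hε : 0 < ε)
    (hε1 : ε ≤ 1) (hB : 0 ≤ B) (hF : F ∈ momentClass ε B) (hb : 0 < b) (hσ : |σ| = 1)
    (hc : B * b ^ (-ε) ≤ c) :
    ∫ x, Real.exp (b⁻¹ * (σ * (truncate b x - mean F) - c)) ∂(F : Measure ℝ) ≤ 1 := by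
  have hF' := (mem_momentClass_iff hB).mp hF
  have hid := integrable_id_of_mem_momentClass hε.le hB hF
  have hr : Integrable (fun x => 1 + b⁻¹ * (σ * x) + (b ^ (1 + ε))⁻¹ * |x| ^ (1 + ε))
      (F : Measure ℝ) :=
    ((integrable_const 1).add ((hid.const_mul σ).const_mul b⁻¹)).add (hF'.1.const_mul _)
  have hl : Integrable (fun x => Real.exp (b⁻¹ * (σ * truncate b x))) (F : Measure ℝ) := by
    have := measurable_truncate b
    refine integrable_exp_of_abs_le (C := b⁻¹ * b) (by fun_prop) fun x => ?_
    rw [abs_mul, abs_mul, hσ, abs_of_pos (inv_pos.mpr hb), one_mul]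
    gcongr
    exact abs_truncate_le hb.le x
  have hbound : ∫ x, Real.exp (b⁻¹ * (σ * truncate b x)) ∂(F : Measure ℝ) ≤
      Real.exp (b⁻¹ * (σ * mean F + c)) := by
    calc _ ≤ ∫ x, (1 + b⁻¹ * (σ * x) + (b ^ (1 + ε))⁻¹ * |x| ^ (1 + ε)) ∂(F : Measure ℝ) :=
          integral_mono hl hr fun x => exp_truncate_le hε hε1 hb hσ x
      _ = 1 + b⁻¹ * (σ * mean F) +
          (b ^ (1 + ε))⁻¹ * ∫ x, |x| ^ (1 + ε) ∂(F : Measure ℝ) := by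
        have hlin : Integrable (fun x => 1 + b⁻¹ * (σ * x)) (F : Measure ℝ) :=
          (integrable_const 1).add ((hid.const_mul σ).const_mul b⁻¹)
        rw [integral_add hlin (hF'.1.const_mul _), integral_add (integrable_const 1)
          ((hid.const_mul σ).const_mul b⁻¹), integral_const_mul, integral_const_mul,
          integral_const_mul]
        simp [mean]
      _ ≤ 1 + b⁻¹ * (σ * mean F) + (b ^ (1 + ε))⁻¹ * B := by
        gcongr
        exact hF'.2
      -- The moment term is `b⁻¹` times the bias bound `B * b ^ (-ε)`, hence at most `b⁻¹ * c`.
      _ ≤ b⁻¹ * (σ * mean F + c) + 1 := by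
        have : (b ^ (1 + ε))⁻¹ * B = b⁻¹ * (B * b ^ (-ε)) := by
          rw [Real.rpow_add hb, Real.rpow_one, Real.rpow_neg hb.le]
          field_simp
        rw [this, mul_add]
        have := mul_le_mul_of_nonneg_left hc (inv_pos.mpr hb).le
        linarith
      _ ≤ _ := Real.add_one_le_exp _
  calc _ = ∫ x, Real.exp (-(b⁻¹ * (σ * mean F + c))) * Real.exp (b⁻¹ * (σ * truncate b x))
        ∂(F : Measure ℝ) := by
        congr 1 with x
        rw [← Real.exp_add]
        congr 1
        ring
    _ ≤ Real.exp (-(b⁻¹ * (σ * mean F + c))) * Real.exp (b⁻¹ * (σ * mean F + c)) := by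
        rw [integral_const_mul]
        gcongr
    _ = 1 := by rw [← Real.exp_add]; simp

instance {k : ℕ} (ν : Fin k → ProbabilityMeasure ℝ) : IsProbabilityMeasure (rewardLaw ν) := by
  unfold rewardLaw
  infer_instance

lemma rewardLaw_sum_ge_le {k : ℕ} (ν : Fin k → ProbabilityMeasure ℝ) (i : Fin k) {g : ℝ → ℝ}
    (hg : Measurable g) {C : ℝ} (hC : ∀ y, |g y| ≤ C) {l : ℝ} (hl : 0 ≤ l)
    (h1 : ∫ y, Real.exp (l * g y) ∂(ν i : Measure ℝ) ≤ 1) (u : ℕ) (a : ℝ) :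
    (rewardLaw ν).real {x | a ≤ ∑ j ∈ Finset.range u, g (x (i, j))} ≤ Real.exp (-l * a) := by
  have hind : iIndepFun (fun (j : ℕ) (x : Fin k × ℕ → ℝ) => g (x (i, j))) (rewardLaw ν) :=
    (iIndepFun_infinitePi (P := fun p : Fin k × ℕ => (ν p.1 : Measure ℝ))
      (X := fun _ => g) fun _ => hg).precomp (g := Prod.mk i) (Prod.mk_right_injective i)
  have hmeas : ∀ j : ℕ, Measurable fun x : Fin k × ℕ → ℝ => g (x (i, j)) := fun j => by fun_prop
  have hint : Integrable (fun x : Fin k × ℕ → ℝ =>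
      Real.exp (l * (∑ j ∈ Finset.range u, fun x : Fin k × ℕ → ℝ => g (x (i, j))) x))
      (rewardLaw ν) := by
    refine hind.integrable_exp_mul_sum hmeas fun j _ => ?_
    refine integrable_exp_of_abs_le (C := l * C) (by fun_prop) fun x => ?_
    rw [abs_mul, abs_of_nonneg hl]
    gcongr
    exact hC _
  have hch := measure_ge_le_exp_mul_mgf a hl hint
  rw [hind.mgf_sum hmeas] at hch
  have hmgf : ∀ j : ℕ, mgf (fun x : Fin k × ℕ → ℝ => g (x (i, j))) (rewardLaw ν) l ≤ 1 := by
    intro j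
    have hmp := measurePreserving_eval_infinitePi
      (fun p : Fin k × ℕ => (ν p.1 : Measure ℝ)) (i, j)
    have : ∫ y, Real.exp (l * g y) ∂(ν i : Measure ℝ) =
        ∫ x, Real.exp (l * g (x (i, j))) ∂(rewardLaw ν) := by
      have hm : AEStronglyMeasurable (fun y => Real.exp (l * g y)) (Measure.map
          (Function.eval (i, j)) (Measure.infinitePi
            fun p : Fin k × ℕ => (ν p.1 : Measure ℝ))) :=
        (by fun_prop : Measurable fun y => Real.exp (l * g y)).aestronglyMeasurable
      have := integral_map hmp.measurable.aemeasurable hm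
      rw [hmp.map_eq] at this
      exact this
    rw [mgf, ← this]
    exact h1
  have hprod : ∏ j ∈ Finset.range u,
      mgf (fun x : Fin k × ℕ → ℝ => g (x (i, j))) (rewardLaw ν) l ≤ 1 :=
    Finset.prod_le_one (fun _ _ => mgf_nonneg) fun j _ => hmgf j
  simp only [Finset.sum_apply] at hch
  exact hch.trans (mul_le_of_le_one_right (Real.exp_pos _).le hprod)

lemma rewardLaw_truncate_ge_le {k : ℕ} (ν : Fin k → ProbabilityMeasure ℝ) (i : Fin k)
    {ε B b c σ : ℝ} (hε : 0 < ε) (hε1 : ε ≤ 1) (hB : 0 ≤ B) (hν : ν i ∈ momentClass ε B)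
    (hb : 0 < b) (hσ : |σ| = 1) (hc : B * b ^ (-ε) ≤ c) (u : ℕ) (a : ℝ) :
    (rewardLaw ν).real
      {x | a ≤ ∑ j ∈ Finset.range u, (σ * (truncate b (x (i, j)) - mean (ν i)) - c)} ≤
      Real.exp (-b⁻¹ * a) := by
  have := measurable_truncate b
  refine rewardLaw_sum_ge_le ν i (g := fun y => σ * (truncate b y - mean (ν i)) - c)
    (by fun_prop) (C := b + |mean (ν i)| + |c|) (fun y => ?_) (inv_pos.mpr hb).le
    (integral_exp_truncate_le_one hε hε1 hB hν hb hσ hc) u a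
  refine (abs_sub _ _).trans ?_
  rw [abs_mul, hσ, one_mul]
  have h1 := abs_sub (truncate b y) (mean (ν i))
  have h2 := abs_truncate_le hb.le y
  linarith

/-! ### Numbers of pulls -/

/-- The event that after some number `u ≤ n` of pulls of arm `i`, the sum of the truncated rewards
deviates from `u * mean (ν i)` in the direction `σ` by at least `u` confidence widths of round
`n + 1`. -/
def deviationEvent (f : ℕ → ℝ) {k : ℕ} (ν : Fin k → ProbabilityMeasure ℝ) (i : Fin k) (σ : ℝ)
    (n : ℕ) : Set (Fin k × ℕ → ℝ) :=
  ⋃ u ∈ Finset.Icc 1 n, {x | 16 * f (n + 1) * Real.log (n + 1 : ℕ) ≤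
    ∑ j ∈ Finset.range u,
      (σ * (truncate (f (n + 1)) (x (i, j)) - mean (ν i)) - 1 / Real.log (f (n + 1)))}

lemma measurableSet_deviationEvent (f : ℕ → ℝ) {k : ℕ} (ν : Fin k → ProbabilityMeasure ℝ)
    (i : Fin k) (σ : ℝ) (n : ℕ) : MeasurableSet (deviationEvent f ν i σ n) := by
  have := measurable_truncate (f (n + 1))
  refine Finset.measurableSet_biUnion _ fun u _ => measurableSet_le measurable_const ?_
  fun_prop

lemma rewardLaw_deviationEvent_le {f : ℕ → ℝ} {k : ℕ} (ν : Fin k → ProbabilityMeasure ℝ)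
    (i : Fin k) {ε B σ : ℝ} (hε : 0 < ε) (hε1 : ε ≤ 1) (hB : 0 ≤ B) (hν : ν i ∈ momentClass ε B)
    (hσ : |σ| = 1) {n : ℕ} (hf : 0 < f (n + 1))
    (hc : B * f (n + 1) ^ (-ε) ≤ 1 / Real.log (f (n + 1))) :
    (rewardLaw ν).real (deviationEvent f ν i σ n) ≤ 1 / ((n : ℝ) + 1) ^ 2 := by
  have hn : (0 : ℝ) < (n : ℝ) + 1 := by positivity
  have hexp : Real.exp (-(f (n + 1))⁻¹ * (16 * f (n + 1) * Real.log (n + 1 : ℕ))) ≤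
      (((n : ℝ) + 1) ^ 3)⁻¹ := by
    have hlog : 0 ≤ Real.log ((n : ℝ) + 1) := Real.log_nonneg (by linarith [n.cast_nonneg (α := ℝ)])
    have : -(f (n + 1))⁻¹ * (16 * f (n + 1) * Real.log (n + 1 : ℕ)) =
        -(16 * Real.log ((n : ℝ) + 1)) := by
      push_cast
      field_simp
    rw [this]
    -- Exponent 3 of the available 16 suffices: the union over `u ≤ n` costs one power and leaves a
    -- summable square.
    calc _ ≤ Real.exp (-(3 * Real.log ((n : ℝ) + 1))) := Real.exp_le_exp.mpr (by linarith)
      _ = _ := by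
        rw [Real.exp_neg, mul_comm, Real.exp_mul, Real.exp_log hn]
        norm_cast
  calc _ ≤ ∑ u ∈ Finset.Icc 1 n, (rewardLaw ν).real _ := measureReal_biUnion_finset_le _ _
    _ ≤ ∑ u ∈ Finset.Icc 1 n, (((n : ℝ) + 1) ^ 3)⁻¹ := Finset.sum_le_sum fun u _ =>
        (rewardLaw_truncate_ge_le ν i hε hε1 hB hν hf hσ hc u _).trans hexp
    _ = n * (((n : ℝ) + 1) ^ 3)⁻¹ := by simp
    _ ≤ 1 / ((n : ℝ) + 1) ^ 2 := by
        rw [← div_eq_mul_inv, div_le_div_iff₀ (by positivity) (by positivity)]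
        nlinarith [pow_pos hn 2]

lemma mul_truncMean_sub_lt_width {f : ℕ → ℝ} {k : ℕ} {ν : Fin k → ProbabilityMeasure ℝ}
    {π : Policy k} {x : Fin k × ℕ → ℝ} {i : Fin k} {σ : ℝ} {n : ℕ}
    (hx : x ∉ deviationEvent f ν i σ n) (hpos : 0 < pulls (history π x n) i) :
    σ * (truncMean (history π x n) i (f (n + 1)) - mean (ν i)) <
      width f (pulls (history π x n) i) (n + 1) := by
  have hle := pulls_le (history π x n) i
  rw [truncMean_history, width]
  generalize pulls (history π x n) i = u at *
  simp only [deviationEvent, Set.mem_iUnion, Finset.mem_Icc, Set.mem_ofPred_eq, not_exists,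
    not_le] at hx
  have h := hx u ⟨hpos, hle⟩
  rw [Finset.sum_sub_distrib, ← Finset.mul_sum, Finset.sum_sub_distrib] at h
  simp only [Finset.sum_const, Finset.card_range, nsmul_eq_mul] at h
  have hu : (0 : ℝ) < u := by exact_mod_cast hpos
  have h1 : σ * ((∑ j ∈ Finset.range u, truncate (f (n + 1)) (x (i, j))) / u - mean (ν i)) =
      (σ * (∑ j ∈ Finset.range u, truncate (f (n + 1)) (x (i, j)) - u * mean (ν i))) / u := by
    field_simp
  rw [h1, div_lt_iff₀ hu, add_mul, div_mul_cancel₀ _ hu.ne']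
  linarith

/-- Arm `j` is not underestimated and arm `i` not overestimated, so `mean j < ucb j ≤ ucb i < mean i
+ 2 * width`; the width of `j` cancels. -/
lemma IsRUCBG.mean_sub_mean_lt {f : ℕ → ℝ} {k : ℕ} {π : Policy k} (hπ : IsRUCBG f π)
    {ν : Fin k → ProbabilityMeasure ℝ} {x : Fin k × ℕ → ℝ} {i j : Fin k} {n : ℕ} (hn : k ≤ n)
    (hi : x ∉ deviationEvent f ν i 1 n) (hj : x ∉ deviationEvent f ν j (-1) n)
    (harm : π.arm n (history π x n) = i) :
    mean (ν j) - mean (ν i) < 2 * width f (pulls (history π x n) i) (n + 1) := by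
  have hpos : ∀ l, 0 < pulls (history π x n) l := fun l => hπ.pulls_pos x l (l.2.trans_le hn)
  have h1 := mul_truncMean_sub_lt_width hi (hpos i)
  have h2 := mul_truncMean_sub_lt_width hj (hpos j)
  have h3 := hπ.maximize n (history π x n) hn hpos j
  rw [harm, ucb, ucb] at h3
  linarith

/-- At an earlier round `s` the bias term `2 / log (f s)` is larger than at `t`, but the other term
shrinks by at least the factor `r = f s / f t`. The gain `(1 - r) * (D - 2 / b)` pays for the loss
`2 / a - 2 / b`: for `r ≥ 1 / 2` because `log` varies slowly, for `r ≤ 1 / 2` because each term is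
at most `D / 2`. -/
lemma two_mul_width_le {f : ℕ → ℝ} (hmono : Monotone f) (hf_one : ∀ t, 1 < f t) {D : ℝ}
    (hD : 0 < D) {s t : ℕ} (hs : 1 ≤ s) (hst : s ≤ t) (hlog : 4 / D + 1 ≤ Real.log (f s)) {u : ℕ}
    (hu0 : 0 < u)
    (hu : 32 * f t * Real.log t / (D - 2 / Real.log (f t)) ≤ u) : 2 * width f u s ≤ D := by
  have hfs : 0 < f s := zero_lt_one.trans (hf_one s)
  have hft : 0 < f t := zero_lt_one.trans (hf_one t)
  have hfst : f s ≤ f t := hmono hst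
  have hlogst : Real.log (f s) ≤ Real.log (f t) := Real.log_le_log hfs hfst
  have hu' : (0 : ℝ) < u := by exact_mod_cast hu0
  have hls : 0 ≤ Real.log s := Real.log_natCast_nonneg s
  have hlst : Real.log s ≤ Real.log t :=
    Real.log_le_log (by exact_mod_cast hs) (by exact_mod_cast hst)
  set a := Real.log (f s) with ha
  set b := Real.log (f t) with hb
  have h4 : 0 < 4 / D := by positivity
  have ha0 : 0 < a := by linarith
  have hb0 : 0 < b := by linarith
  have haD : 4 ≤ a * D := by
    have := mul_le_mul_of_nonneg_right hlog hD.le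
    rw [add_mul, div_mul_cancel₀ _ hD.ne'] at this
    linarith
  have hbD : 4 + D ≤ b * D := by
    have := mul_le_mul_of_nonneg_right (hlog.trans hlogst) hD.le
    rw [add_mul, div_mul_cancel₀ _ hD.ne'] at this
    linarith
  have h2a : 2 / a ≤ D / 2 := by
    rw [div_le_div_iff₀ ha0 two_pos]
    linarith
  have h2b : 2 / b ≤ D / 2 := by
    rw [div_le_div_iff₀ hb0 two_pos]
    linarith
  have hE : 0 < D - 2 / b := by linarith
  set r := f s / f t with hr
  have hr0 : 0 < r := div_pos hfs hft
  have hr1 : r ≤ 1 := (div_le_one hft).mpr hfst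
  have hsecond : 32 * f s * Real.log s / u ≤ r * (D - 2 / b) := by
    rw [div_le_iff₀ hE] at hu
    rw [div_le_iff₀ hu']
    have hfsr : f s = r * f t := by rw [hr, div_mul_cancel₀ _ hft.ne']
    calc 32 * f s * Real.log s ≤ 32 * f s * Real.log t := by gcongr
      _ = r * (32 * f t * Real.log t) := by rw [hfsr]; ring
      _ ≤ r * (u * (D - 2 / b)) := by gcongr
      _ = _ := by ring
  have hwidth : 2 * width f u s = 2 / a + 32 * f s * Real.log s / u := by
    rw [width]
    ring
  rw [hwidth]
  rcases le_total r (1 / 2) with h | h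
  · have h5 : r * (D - 2 / b) ≤ 1 / 2 * D := by
      have : 0 < 2 / b := by positivity
      gcongr
      linarith
    linarith
  · have hlogr : b - a ≤ 2 * (1 - r) := by
      have h5 : Real.log r = a - b := by rw [hr, Real.log_div hfs.ne' hft.ne']
      have h6 := Real.one_sub_inv_le_log_of_pos hr0
      -- Equivalent to `(1 - r) * (2 * r - 1) ≥ 0`.
      have h7 : r⁻¹ ≤ 1 + 2 * (1 - r) := by
        rw [inv_le_iff_one_le_mul₀ hr0]
        nlinarith
      linarith
    have h8 : 4 / (a * b) ≤ D - 2 / b := by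
      have : D - 2 / b - 4 / (a * b) = (a * (b * D) - 2 * a - 4) / (a * b) := by
        field_simp
      have h9 : 0 ≤ (a * (b * D) - 2 * a - 4) / (a * b) := by
        refine div_nonneg ?_ (by positivity)
        nlinarith [mul_le_mul_of_nonneg_left hbD ha0.le]
      linarith
    have h10 : 2 / a - 2 / b ≤ (1 - r) * (D - 2 / b) := by
      calc 2 / a - 2 / b = 2 * (b - a) / (a * b) := by field_simp
        _ ≤ 2 * (2 * (1 - r)) / (a * b) := by gcongr
        _ = (1 - r) * (4 / (a * b)) := by ring
        _ ≤ _ := mul_le_mul_of_nonneg_left h8 (by linarith)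
    linarith

lemma IsRUCBG.pulls_le_add_sum {f : ℕ → ℝ} {k : ℕ} {π : Policy k} (hπ : IsRUCBG f π)
    (ν : Fin k → ProbabilityMeasure ℝ) (x : Fin k × ℕ → ℝ) (i j : Fin k) {L : ℝ} {s₀ t : ℕ}
    (hL : s₀ ≤ L)
    (hwidth : ∀ s u : ℕ, s₀ ≤ s → s < t → 0 < u → L ≤ u →
      2 * width f u (s + 1) ≤ mean (ν j) - mean (ν i)) {n : ℕ} (hn : n ≤ t) :
    (pulls (history π x n) i : ℝ) ≤ L + 1 + ∑ s ∈ Finset.Ico s₀ n,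
      ((deviationEvent f ν i 1 s).indicator (fun _ => (1 : ℝ)) x +
        (deviationEvent f ν j (-1) s).indicator (fun _ => (1 : ℝ)) x) := by
  have hs₀ : (0 : ℝ) ≤ s₀ := s₀.cast_nonneg
  have h0 : ∀ s, 0 ≤ (deviationEvent f ν i 1 s).indicator (fun _ => (1 : ℝ)) x +
      (deviationEvent f ν j (-1) s).indicator (fun _ => (1 : ℝ)) x := fun s =>
    add_nonneg (Set.indicator_nonneg (fun _ _ => zero_le_one) x)
      (Set.indicator_nonneg (fun _ _ => zero_le_one) x)
  induction n with
  | zero =>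
    rw [pulls_history_zero]
    have := Finset.sum_nonneg fun s (_ : s ∈ Finset.Ico s₀ 0) => h0 s
    push_cast
    linarith
  | succ n ih =>
    have ih := ih (by omega)
    have hmono := Finset.sum_le_sum_of_subset_of_nonneg
      (Finset.Ico_subset_Ico_right (a := s₀) n.le_succ) fun s _ _ => h0 s
    rw [pulls_history_succ]
    split_ifs with harm
    · push_cast
      rcases le_or_gt (pulls (history π x n) i : ℝ) L with h | h
      · have := Finset.sum_nonneg fun s (_ : s ∈ Finset.Ico s₀ (n + 1)) => h0 s
        linarith
      · have hpos : 0 < pulls (history π x n) i := by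
          have : (0 : ℝ) < pulls (history π x n) i := by linarith
          exact_mod_cast this
        -- More than `L ≥ s₀` pulls need more than `s₀` rounds, so the early rounds never have to be
        -- charged.
        have hs₀n : s₀ ≤ n := by
          have h1 : (s₀ : ℝ) < pulls (history π x n) i := by linarith
          have h2 : s₀ < pulls (history π x n) i := by exact_mod_cast h1
          exact h2.le.trans (pulls_le _ _)
        -- An initial round pulls its arm for the first time, yet arm `i` already has a pull.
        have hkn : k ≤ n := by
          by_contra! hlt
          have h1 := hπ.init n (history π x n) hlt
          rw [hπ.pulls_eq_zero x i (by rw [← harm, h1])] at hpos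
          omega
        have hone : 1 ≤ (deviationEvent f ν i 1 n).indicator (fun _ => (1 : ℝ)) x +
            (deviationEvent f ν j (-1) n).indicator (fun _ => (1 : ℝ)) x := by
          by_cases hi : x ∈ deviationEvent f ν i 1 n
          · rw [Set.indicator_of_mem hi]
            have := Set.indicator_nonneg (s := deviationEvent f ν j (-1) n)
              (f := fun _ => (1 : ℝ)) (fun _ _ => zero_le_one) x
            linarith
          · by_cases hj : x ∈ deviationEvent f ν j (-1) n
            · rw [Set.indicator_of_mem hj, Set.indicator_of_notMem hi]
              norm_num
            · have h1 := hπ.mean_sub_mean_lt hkn hi hj harm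
              have h2 := hwidth n _ hs₀n (by omega) hpos h.le
              linarith
        rw [Finset.sum_Ico_succ_top hs₀n]
        linarith
    · push_cast
      linarith

lemma sum_Ico_one_div_sq_le {a b : ℕ} (ha : 1 ≤ a) :
    ∑ s ∈ Finset.Ico a b, 1 / ((s : ℝ) + 1) ^ 2 ≤ 1 := by
  rcases le_total b a with h | h
  · rw [Finset.Ico_eq_empty_of_le h]
    simp
  have ha' : (1 : ℝ) ≤ a := by exact_mod_cast ha
  calc ∑ s ∈ Finset.Ico a b, 1 / ((s : ℝ) + 1) ^ 2
      ≤ ∑ s ∈ Finset.Ico a b, (-((s + 1 : ℕ) : ℝ)⁻¹ - -(s : ℝ)⁻¹) := by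
        refine Finset.sum_le_sum fun s hs => ?_
        have hs' : (0 : ℝ) < s := by
          exact_mod_cast ha.trans (Finset.mem_Ico.mp hs).1
        push_cast
        have : -((s : ℝ) + 1)⁻¹ - -(s : ℝ)⁻¹ = 1 / (s * (s + 1)) := by field_simp; ring
        rw [this]
        apply one_div_le_one_div_of_le (by positivity)
        nlinarith
    _ = (a : ℝ)⁻¹ - (b : ℝ)⁻¹ := by
        rw [Finset.sum_Ico_sub (fun s : ℕ => -(s : ℝ)⁻¹) h]
        ring
    _ ≤ 1 := by
        have := inv_le_one_of_one_le₀ ha'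
        have : (0 : ℝ) ≤ (b : ℝ)⁻¹ := by positivity
        linarith

lemma IsRUCBG.integral_pulls_le {f : ℕ → ℝ} (hf_one : ∀ t, 1 < f t) {k : ℕ} {π : Policy k}
    (hπ : IsRUCBG f π) {ν : Fin k → ProbabilityMeasure ℝ} {ε B : ℝ} (hε : 0 < ε) (hε1 : ε ≤ 1)
    (hB : 0 ≤ B) (hν : ∀ i, ν i ∈ momentClass ε B) (i j : Fin k) {L : ℝ} {s₀ t : ℕ}
    (hs₀ : 1 ≤ s₀) (hL : s₀ ≤ L)
    (hbias : ∀ s, s₀ ≤ s → B * f s ^ (-ε) ≤ 1 / Real.log (f s))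
    (hwidth : ∀ s u : ℕ, s₀ ≤ s → s < t → 0 < u → L ≤ u →
      2 * width f u (s + 1) ≤ mean (ν j) - mean (ν i)) :
    ∫ x, (pulls (history π x t) i : ℝ) ∂(rewardLaw ν) ≤ L + 3 := by
  have hind : ∀ (l : Fin k) (σ : ℝ) (s : ℕ),
      Integrable ((deviationEvent f ν l σ s).indicator fun _ => (1 : ℝ)) (rewardLaw ν) :=
    fun l σ s => (integrable_const 1).indicator (measurableSet_deviationEvent f ν l σ s)
  have hsum : Integrable (fun x => ∑ s ∈ Finset.Ico s₀ t,
      ((deviationEvent f ν i 1 s).indicator (fun _ => (1 : ℝ)) x +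
        (deviationEvent f ν j (-1) s).indicator (fun _ => (1 : ℝ)) x)) (rewardLaw ν) :=
    integrable_finsetSum _ fun s _ => (hind i 1 s).add (hind j (-1) s)
  have hdev : ∀ (l : Fin k) (σ : ℝ), |σ| = 1 → ∀ s, s₀ ≤ s →
      ∫ x, (deviationEvent f ν l σ s).indicator (fun _ => (1 : ℝ)) x ∂(rewardLaw ν) ≤
        1 / ((s : ℝ) + 1) ^ 2 := by
    intro l σ hσ s hs
    rw [integral_indicator_const _ (measurableSet_deviationEvent f ν l σ s), smul_eq_mul, mul_one]
    exact rewardLaw_deviationEvent_le ν l hε hε1 hB (hν l) hσ (zero_lt_one.trans (hf_one _))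
      (hbias _ (by omega))
  calc _ ≤ ∫ x, (L + 1 + ∑ s ∈ Finset.Ico s₀ t,
        ((deviationEvent f ν i 1 s).indicator (fun _ => (1 : ℝ)) x +
          (deviationEvent f ν j (-1) s).indicator (fun _ => (1 : ℝ)) x)) ∂(rewardLaw ν) :=
        -- Only the dominating function must be integrable, so measurability of the pull count is
        -- not needed.
        integral_mono_of_nonneg (ae_of_all _ fun x => Nat.cast_nonneg _)
          ((integrable_const _).add hsum)
          (ae_of_all _ fun x => hπ.pulls_le_add_sum ν x i j hL hwidth le_rfl)
    _ = L + 1 + ∑ s ∈ Finset.Ico s₀ t,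
        (∫ x, (deviationEvent f ν i 1 s).indicator (fun _ => (1 : ℝ)) x ∂(rewardLaw ν) +
          ∫ x, (deviationEvent f ν j (-1) s).indicator (fun _ => (1 : ℝ)) x ∂(rewardLaw ν)) := by
        rw [integral_add (integrable_const _) hsum, integral_finsetSum]
        · congr 1
          · simp
          · exact Finset.sum_congr rfl fun s _ => integral_add (hind i 1 s) (hind j (-1) s)
        · exact fun s _ => (hind i 1 s).add (hind j (-1) s)
    _ ≤ L + 1 + ∑ s ∈ Finset.Ico s₀ t, 2 * (1 / ((s : ℝ) + 1) ^ 2) := by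
        refine add_le_add_right (Finset.sum_le_sum fun s hs => ?_) _
        have h1 := hdev i 1 (by simp) s (Finset.mem_Ico.mp hs).1
        have h2 := hdev j (-1) (by simp) s (Finset.mem_Ico.mp hs).1
        linarith
    _ ≤ L + 3 := by
        rw [← Finset.mul_sum]
        have := sum_Ico_one_div_sq_le (b := t) hs₀
        linarith

/-! ### Regret bounds -/

lemma SlowGrowing.monotone {f : ℕ → ℝ} (hf : SlowGrowing f) : Monotone f :=
  monotone_nat_of_le_succ hf.le_succ

lemma gap_nonneg {k : ℕ} (ν : Fin k → ProbabilityMeasure ℝ) (i : Fin k) : 0 ≤ gap ν i :=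
  sub_nonneg.mpr (le_ciSup (f := fun j => mean (ν j)) (Set.finite_range _).bddAbove i)

lemma exists_gap_eq {k : ℕ} (ν : Fin k → ProbabilityMeasure ℝ) (i : Fin k) :
    ∃ j, gap ν i = mean (ν j) - mean (ν i) := by
  have : Nonempty (Fin k) := ⟨i⟩
  obtain ⟨j, hj⟩ := exists_eq_ciSup_of_finite (f := fun j => mean (ν j))
  exact ⟨j, by rw [gap, ← hj]⟩

lemma regret_nonneg {k : ℕ} (π : Policy k) (ν : Fin k → ProbabilityMeasure ℝ) (n : ℕ) :
    0 ≤ regret π ν n :=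
  Finset.sum_nonneg fun i _ =>
    mul_nonneg (gap_nonneg ν i) (integral_nonneg fun _ => Nat.cast_nonneg _)

lemma regret_eq_sum_pos_gap {k : ℕ} (π : Policy k) (ν : Fin k → ProbabilityMeasure ℝ) (n : ℕ) :
    regret π ν n =
      ∑ i with 0 < gap ν i, gap ν i * ∫ x, (pulls (history π x n) i : ℝ) ∂(rewardLaw ν) := by
  rw [regret, Finset.sum_filter]
  refine Finset.sum_congr rfl fun i _ => ?_
  split_ifs with h
  · rfl
  · rw [le_antisymm (not_lt.mp h) (gap_nonneg ν i), zero_mul]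

lemma gap_le_of_momentClass {k : ℕ} {ν : Fin k → ProbabilityMeasure ℝ} {ε B : ℝ} (hε : 0 ≤ ε)
    (hB : 0 ≤ B) (hν : ∀ i, ν i ∈ momentClass ε B) (i : Fin k) : gap ν i ≤ 2 * (1 + B) := by
  obtain ⟨j, hj⟩ := exists_gap_eq ν i
  have h1 := (abs_le.mp (abs_mean_le hε hB (hν i))).1
  have h2 := (abs_le.mp (abs_mean_le hε hB (hν j))).2
  linarith

lemma eventually_bias_le {f : ℕ → ℝ} (hf : Tendsto f atTop atTop) {ε B : ℝ} (hε : 0 < ε) :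
    ∀ᶠ s in atTop, B * f s ^ (-ε) ≤ 1 / Real.log (f s) := by
  have h1 : ∀ᶠ y : ℝ in atTop, B * y ^ (-ε) ≤ 1 / Real.log y := by
    have h2 := (isLittleO_log_rpow_atTop hε).def (c := (|B| + 1)⁻¹) (by positivity)
    filter_upwards [h2, eventually_gt_atTop 1] with y hy hy1
    have hy0 : 0 < y := by linarith
    have hlog : 0 < Real.log y := Real.log_pos hy1
    have hpow : 0 < y ^ ε := Real.rpow_pos_of_pos hy0 ε
    rw [Real.norm_of_nonneg hlog.le, Real.norm_of_nonneg hpow.le, inv_mul_eq_div,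
      le_div_iff₀ (by positivity)] at hy
    rw [Real.rpow_neg hy0.le, ← div_eq_mul_inv, div_le_div_iff₀ hpow hlog]
    nlinarith [le_abs_self B]
  exact hf.eventually h1

lemma one_sub_div_mul_log_pos {D l : ℝ} (hD : 0 < D) (hl : 4 / D + 1 ≤ l) :
    0 < 1 - 2 / (D * l) := by
  have h4 : 0 < 4 / D := by positivity
  have hl0 : 0 < l := by linarith
  have h := mul_le_mul_of_nonneg_left hl hD.le
  rw [mul_add, mul_div_cancel₀ _ hD.ne'] at h
  rw [sub_pos, div_lt_one (by positivity)]
  linarith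

lemma IsRUCBG.regret_le {f : ℕ → ℝ} (hf : SlowGrowing f) (hf_one : ∀ t, 1 < f t) {k : ℕ}
    {π : Policy k} (hπ : IsRUCBG f π) {ν : Fin k → ProbabilityMeasure ℝ} {ε B δ : ℝ} (hε : 0 < ε)
    (hε1 : ε ≤ 1) (hB : 0 ≤ B) (hδ : 0 < δ) (hν : ∀ i, ν i ∈ momentClass ε B)
    (hgap : ∀ i, 0 < gap ν i → δ ≤ gap ν i) {s₀ t : ℕ} (hs₀ : 1 ≤ s₀)
    (hbias : ∀ s, s₀ ≤ s → B * f s ^ (-ε) ≤ 1 / Real.log (f s))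
    (hlog : ∀ s, s₀ ≤ s → 4 / δ + 1 ≤ Real.log (f s)) (ht : s₀ ≤ t)
    (hlarge : s₀ * (2 * (1 + B)) ≤ 32 * f t * Real.log t) :
    regret π ν t ≤ ∑ i with 0 < gap ν i,
      (32 * f t * Real.log t / (1 - 2 / (gap ν i * Real.log (f t))) + 4 * gap ν i) := by
  rw [regret_eq_sum_pos_gap]
  refine Finset.sum_le_sum fun i hi => ?_
  have hD : 0 < gap ν i := (Finset.mem_filter.mp hi).2
  obtain ⟨j, hj⟩ := exists_gap_eq ν i
  have hlogD : ∀ s, s₀ ≤ s → 4 / gap ν i + 1 ≤ Real.log (f s) := fun s hs =>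
    le_trans (by gcongr; exact hgap i hD) (hlog s hs)
  have hlogt : 0 < Real.log (f t) := Real.log_pos (hf_one t)
  have hone := one_sub_div_mul_log_pos hD (hlogD t ht)
  have hfac : gap ν i - 2 / Real.log (f t) =
      gap ν i * (1 - 2 / (gap ν i * Real.log (f t))) := by
    field_simp
  have hden : 0 < gap ν i - 2 / Real.log (f t) := by
    rw [hfac]
    positivity
  -- The denominator is at most the gap, hence at most `2 * (1 + B)`.
  have hL : (s₀ : ℝ) ≤ 32 * f t * Real.log t / (gap ν i - 2 / Real.log (f t)) := by
    rw [le_div_iff₀ hden]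
    refine le_trans (mul_le_mul_of_nonneg_left ?_ s₀.cast_nonneg) hlarge
    have := gap_le_of_momentClass hε.le hB hν i
    have : 0 < 2 / Real.log (f t) := by positivity
    linarith
  have hpulls := hπ.integral_pulls_le (t := t) hf_one hε hε1 hB hν i j hs₀ hL hbias
    fun s u hs hst hu hLu => hj ▸ two_mul_width_le hf.monotone hf_one hD (by omega) (by omega)
      (hlogD _ (by omega)) hu hLu
  calc _ ≤ gap ν i * (32 * f t * Real.log t / (gap ν i - 2 / Real.log (f t)) + 3) := by gcongr
    _ = 32 * f t * Real.log t / (1 - 2 / (gap ν i * Real.log (f t))) + 3 * gap ν i := by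
        rw [hfac, mul_add, ← mul_div_assoc, mul_div_mul_left _ _ hD.ne']
        ring
    _ ≤ _ := by linarith

lemma SlowGrowing.exists_regret_threshold {f : ℕ → ℝ} (hf : SlowGrowing f)
    (hf_one : ∀ t, 1 < f t) {ε B δ : ℝ} (hε : 0 < ε) (hB : 0 < B) (hδ : 0 < δ) :
    ∃ tmin : ℕ, ∀ (k : ℕ) (π : Policy k), IsRUCBG f π →
      ∀ ν : Fin k → ProbabilityMeasure ℝ, (∀ i, ν i ∈ momentClass ε B) →
      (∀ i, 0 < gap ν i → δ ≤ gap ν i) → ∀ t : ℕ, tmin < t →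
        (∀ i, 0 < gap ν i → 0 < 1 - 2 / (gap ν i * Real.log (f t))) ∧
        regret π ν t ≤ ∑ i with 0 < gap ν i,
          (32 * f t * Real.log t / (1 - 2 / (gap ν i * Real.log (f t))) + 4 * gap ν i) := by
  have hε' : 0 < min ε 1 := lt_min hε one_pos
  obtain ⟨s₁, hs₁⟩ := eventually_atTop.mp
    (eventually_bias_le (B := 1 + B) hf.tendsto_atTop hε')
  obtain ⟨s₂, hs₂⟩ := eventually_atTop.mp
    ((Real.tendsto_log_atTop.comp hf.tendsto_atTop).eventually_ge_atTop (4 / δ + 1))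
  set s₀ := max 1 (max s₁ s₂)
  have hlarge : ∀ᶠ t : ℕ in atTop, s₀ * (2 * (1 + (1 + B))) ≤ 32 * f t * Real.log t :=
    ((hf.tendsto_atTop.const_mul_atTop (by norm_num : (0 : ℝ) < 32)).atTop_mul_atTop₀
      (Real.tendsto_log_atTop.comp tendsto_natCast_atTop_atTop)).eventually_ge_atTop _
  obtain ⟨s₃, hs₃⟩ := eventually_atTop.mp hlarge
  refine ⟨max s₀ s₃, fun k π hπ ν hν hgap t ht => ?_⟩
  -- The exponential estimate needs `ε ≤ 1`; lowering the exponent costs the extra `1` in the moment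
  -- bound.
  have hν' : ∀ i, ν i ∈ momentClass (min ε 1) (1 + B) := fun i =>
    momentClass_subset (by linarith) (min_le_left _ _) hB.le (hν i)
  refine ⟨fun i hi => one_sub_div_mul_log_pos hi (le_trans ?_ (hs₂ t (by omega))),
    hπ.regret_le hf hf_one hε' (min_le_right _ _) (by linarith) hδ hν' hgap (by omega)
      (fun s hs => hs₁ s (by omega)) (fun s hs => hs₂ s (by omega)) (by omega)
      (hs₃ t (by omega))⟩
  gcongr
  exact hgap i hi

/-! ### Asymptotics for a fixed instance -/

lemma exists_momentClass_of_heavyClass {k : ℕ} {ν : Fin k → ProbabilityMeasure ℝ}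
    (hν : ∀ i, ν i ∈ heavyClass) : ∃ ε B : ℝ, 0 < ε ∧ 0 < B ∧ ∀ i, ν i ∈ momentClass ε B := by
  choose e he hfin using hν
  obtain ⟨ε, hε, hεe⟩ : ∃ ε : ℝ, 0 < ε ∧ ∀ i, ε ≤ e i := by
    rcases isEmpty_or_nonempty (Fin k) with h | h
    · exact ⟨1, one_pos, fun i => h.elim i⟩
    · obtain ⟨i, hi⟩ := Finite.exists_min e
      exact ⟨e i, he i, hi⟩
  have hm : ∀ i, ν i ∈ momentClass ε (1 + (∫⁻ x, ENNReal.ofReal (|x| ^ (1 + e i))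
      ∂(ν i : Measure ℝ)).toReal) := fun i =>
    momentClass_subset (by linarith) (hεe i) ENNReal.toReal_nonneg
      (ENNReal.ofReal_toReal (hfin i).ne).ge
  refine ⟨ε, 1 + ∑ i, (∫⁻ x, ENNReal.ofReal (|x| ^ (1 + e i)) ∂(ν i : Measure ℝ)).toReal, hε, ?_,
    fun i => momentClass_mono ?_ (hm i)⟩
  · positivity
  · gcongr
    exact Finset.single_le_sum (f := fun i =>
      (∫⁻ x, ENNReal.ofReal (|x| ^ (1 + e i)) ∂(ν i : Measure ℝ)).toReal)
      (fun _ _ => ENNReal.toReal_nonneg) (Finset.mem_univ i)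

lemma exists_le_pos_gap {k : ℕ} (ν : Fin k → ProbabilityMeasure ℝ) :
    ∃ δ : ℝ, 0 < δ ∧ ∀ i, 0 < gap ν i → δ ≤ gap ν i := by
  rcases (Finset.univ.filter fun i => 0 < gap ν i).eq_empty_or_nonempty with h | h
  · refine ⟨1, one_pos, fun i hi => absurd hi ?_⟩
    simpa using Finset.filter_eq_empty_iff.mp h (Finset.mem_univ i)
  · obtain ⟨i, hi, hmin⟩ := Finset.exists_min_image _ (gap ν) h
    exact ⟨gap ν i, (Finset.mem_filter.mp hi).2, fun j hj => hmin j (by simpa using hj)⟩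

lemma SlowGrowing.isBigO_regret_bound {f : ℕ → ℝ} (hf : SlowGrowing f) {D : ℝ} (hD : 0 < D) :
    (fun n : ℕ => 32 * f n * Real.log n / (1 - 2 / (D * Real.log (f n))) + 4 * D)
      =O[atTop] fun n : ℕ => f n * Real.log n := by
  have hlog : Tendsto (fun n : ℕ => Real.log (f n)) atTop atTop :=
    Real.tendsto_log_atTop.comp hf.tendsto_atTop
  have hden : Tendsto (fun n : ℕ => 1 - 2 / (D * Real.log (f n))) atTop (𝓝 1) := by
    simpa using tendsto_const_nhds.sub
      ((hlog.const_mul_atTop hD).const_div_atTop (2 : ℝ))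
  have hinv : (fun n : ℕ => 32 * (1 - 2 / (D * Real.log (f n)))⁻¹) =O[atTop]
      fun _ => (1 : ℝ) := ((hden.inv₀ one_ne_zero).const_mul 32).isBigO_one ℝ
  have hprod : Tendsto (fun n : ℕ => f n * Real.log n) atTop atTop :=
    hf.tendsto_atTop.atTop_mul_atTop₀
      (Real.tendsto_log_atTop.comp tendsto_natCast_atTop_atTop)
  refine IsBigO.add ?_ ((isLittleO_const_left.mpr
    (Or.inr (tendsto_norm_atTop_atTop.comp hprod))).isBigO)
  simpa [mul_comm, mul_left_comm, mul_assoc, div_eq_mul_inv] using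
    (isBigO_refl (fun n : ℕ => f n * Real.log n) atTop).mul hinv

lemma SlowGrowing.regret_isBigO {f : ℕ → ℝ} (hf : SlowGrowing f) (hf_one : ∀ t, 1 < f t) {k : ℕ}
    {π : Policy k} (hπ : IsRUCBG f π) {ν : Fin k → ProbabilityMeasure ℝ}
    (hν : ∀ i, ν i ∈ heavyClass) :
    (fun n : ℕ => regret π ν n) =O[atTop] fun n : ℕ => f n * Real.log n := by
  obtain ⟨ε, B, hε, hB, hν'⟩ := exists_momentClass_of_heavyClass hν
  obtain ⟨δ, hδ, hgap⟩ := exists_le_pos_gap ν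
  obtain ⟨tmin, htmin⟩ := hf.exists_regret_threshold hf_one hε hB hδ
  refine IsBigO.trans (IsBigO.of_bound' ?_) (IsBigO.fun_sum (s := {i | 0 < gap ν i}) fun i hi =>
    hf.isBigO_regret_bound (D := gap ν i) (by simpa using hi))
  filter_upwards [eventually_gt_atTop tmin] with n hn
  rw [Real.norm_of_nonneg (regret_nonneg π ν n)]
  exact (htmin k π hπ ν hν' hgap n hn).2.trans (Real.le_norm_self _)

lemma SlowGrowing.mul_log_isLittleO {f : ℕ → ℝ} (hf : SlowGrowing f) {a : ℝ} (ha : 0 < a) :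
    (fun n : ℕ => f n * Real.log n) =o[atTop] fun n : ℕ => (n : ℝ) ^ a := by
  have h1 : f =o[atTop] fun n : ℕ => (n : ℝ) ^ (a / 2) := by
    refine (isLittleO_iff_tendsto' ?_).mpr (hf.tendsto_div_rpow (a / 2) (half_pos ha))
    filter_upwards [eventually_gt_atTop 0] with n hn h
    exact absurd h (Real.rpow_pos_of_pos (by exact_mod_cast hn) _).ne'
  have h2 : (fun n : ℕ => Real.log n) =o[atTop] fun n : ℕ => (n : ℝ) ^ (a / 2) :=
    (isLittleO_log_rpow_atTop (half_pos ha)).comp_tendsto tendsto_natCast_atTop_atTop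
  refine (h1.mul h2).congr_right fun n => ?_
  rw [← Real.rpow_add_of_nonneg n.cast_nonneg (half_pos ha).le (half_pos ha).le, add_halves]

end Bandit

theorem theorem3 (f : ℕ → ℝ) (hf : Bandit.SlowGrowing f) (hf_one : ∀ t, 1 < f t) :
    (∀ ε B δ : ℝ, 0 < ε → 0 < B → 0 < δ → ∃ tmin : ℕ,
      ∀ (k : ℕ) (π : Bandit.Policy k), Bandit.IsRUCBG f π →
      ∀ ν : Fin k → ProbabilityMeasure ℝ, (∀ i, ν i ∈ Bandit.momentClass ε B) →
      (∀ i, 0 < Bandit.gap ν i → δ ≤ Bandit.gap ν i) →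
      ∀ t : ℕ, tmin < t →
        (∀ i, 0 < Bandit.gap ν i → 0 < 1 - 2 / (Bandit.gap ν i * Real.log (f t))) ∧
        Bandit.regret π ν t ≤
          ∑ i with 0 < Bandit.gap ν i,
            (32 * f t * Real.log t / (1 - 2 / (Bandit.gap ν i * Real.log (f t)))
              + 4 * Bandit.gap ν i)) ∧
    (∀ (k : ℕ) (π : Bandit.Policy k), Bandit.IsRUCBG f π →
      (∀ ν : Fin k → ProbabilityMeasure ℝ, (∀ i, ν i ∈ Bandit.heavyClass) →
        (fun n : ℕ => Bandit.regret π ν n) =O[atTop] (fun n : ℕ => f n * Real.log n)) ∧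
      Bandit.Consistent π Bandit.heavyClass) := by
  refine ⟨fun ε B δ hε hB hδ => hf.exists_regret_threshold hf_one hε hB hδ, fun k π hπ =>
    ⟨fun ν hν => hf.regret_isBigO hf_one hπ hν, fun ν hν a ha => ?_⟩⟩
  exact (hf.regret_isBigO hf_one hπ hν).trans_isLittleO (hf.mul_log_isLittleO ha)
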